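/- Let $R$ be a commutative ring in which $2$ is invertible, let $I$ be an ideal of $R$, let $n\ge 1$, and let $(P,\langle\,,\rangle)$ be a symplectic $R$-module of rank $2n$: $P$ is a finitely generated projective $R$-module of constant rank $2n$, and $\langle\,,\rangle$ is an alternating bilinear form on $P$ for which $x\mapsto\langle x,\cdot\rangle$ is an isomorphism $P\to P^*$. Let $\psi_n=\sum_{i=1}^n e_{2i-1,2i}-\sum_{i=1}^n e_{2i,2i-1}$, and assume that for every maximal ideal $\mathfrak m$ of $R$ the form induced by $\langle\,,\rangle$ on $P_{\mathfrak m}$ has, in some basis of the free $R_{\mathfrak m}$-module $P_{\mathfrak m}$, a matrix $\varphi_{\mathfrak m}\equiv\psi_n \pmod{I R_{\mathfrak m}}$. Let $Q=\mathbb H(R)\perp P$, that is, $R^2\oplus P$ with the form $\langle (a_1,b_1,p_1),(a_2,b_2,p_2)\rangle=a_1b_2-a_2b_1+\langle p_1,p_2\rangle$. Let $\mathrm{Trans}_{\mathrm{Sp}}(Q,IQ)$ be the group of automorphisms of $Q$ generated by the symplectic transvections $$\sigma(x)=x+\langle u,x\rangle v+\langle v,x\rangle u+\alpha\langle u,x\rangle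 u,\qquad u\in Q,\ v\in IQ,\ \alpha\in I,\ \langle u,v\rangle=0.$$ Let $\mathrm{ETrans}_{\mathrm{Sp}}(Q)$ be the group generated by the elementary symplectic transvections $$(a,b,p)\mapsto(a,\;b-\langle q,p\rangle+\alpha a,\;p+aq),\qquad (a,b,p)\mapsto(a+\langle q,p\rangle-\beta b,\;b,\;p+bq)$$ with $q\in P$ and $\alpha,\beta\in R$. Let $\mathrm{ETrans}_{\mathrm{Sp}}(IQ)$ be its subgroup generated by those with $q\in IP$ and $\alpha,\beta\in I$, and let $\mathrm{ETrans}_{\mathrm{Sp}}(Q,IQ)$ be the normal closure of $\mathrm{ETrans}_{\mathrm{Sp}}(IQ)$ in $\mathrm{ETrans}_{\mathrm{Sp}}(Q)$. Then $\mathrm{Trans}_{\mathrm{Sp}}(Q,IQ)=\mathrm{ETrans}_{\mathrm{Sp}}(Q,IQ)$. -/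

import Mathlib

open scoped TensorProduct

namespace SymplecticTransvection

section Forms

variable {R : Type*} [CommRing R]

/-- A form on `P` is symplectic: it is alternating, and `x ↦ ⟨x, ·⟩` is an isomorphism from `P`
onto its dual. -/
structure IsSymplecticForm {P : Type*} [AddCommGroup P] [Module R P]
    (B : LinearMap.BilinForm R P) : Prop where
  isAlt : B.IsAlt
  bijective : Function.Bijective (fun x : P => (B x : Module.Dual R P))

/-- The hyperbolic plane `ℍ(R)`, on the module `R²`:
`⟨(a₁, b₁), (a₂, b₂)⟩ = a₁ b₂ - a₂ b₁`. -/
def hyperbolicForm (R : Type*) [CommRing R] : LinearMap.BilinForm R (R × R) :=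
  LinearMap.mk₂ R (fun x y => x.1 * y.2 - y.1 * x.2)
    (fun x x' y => by simp only [Prod.fst_add, Prod.snd_add]; ring)
    (fun c x y => by simp only [Prod.smul_fst, Prod.smul_snd, smul_eq_mul]; ring)
    (fun x y y' => by simp only [Prod.fst_add, Prod.snd_add]; ring)
    (fun c x y => by simp only [Prod.smul_fst, Prod.smul_snd, smul_eq_mul]; ring)

/-- The orthogonal sum of two forms:
`⟨(p₁, p₂), (q₁, q₂)⟩ = ⟨p₁, q₁⟩₁ + ⟨p₂, q₂⟩₂`. -/
def orthogonalSum {M N : Type*} [AddCommGroup M] [Module R M] [AddCommGroup N] [Module R N]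
    (B₁ : LinearMap.BilinForm R M) (B₂ : LinearMap.BilinForm R N) :
    LinearMap.BilinForm R (M × N) :=
  B₁.compl₁₂ (LinearMap.fst R M N) (LinearMap.fst R M N) +
    B₂.compl₁₂ (LinearMap.snd R M N) (LinearMap.snd R M N)

/-- The form of `Q = ℍ(R) ⊥ P`, on the module `R² × P`. -/
def formQ {P : Type*} [AddCommGroup P] [Module R P] (B : LinearMap.BilinForm R P) :
    LinearMap.BilinForm R ((R × R) × P) :=
  orthogonalSum (hyperbolicForm R) B

/-- The standard alternating matrix `ψ_n = ∑ e_{2i-1,2i} - ∑ e_{2i,2i-1}`. The rows and columns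
are numbered from `0` here, so the entries `1` stand at `(2k, 2k+1)` and the entries `-1` at
`(2k+1, 2k)`. -/
def standardAlternating (n : ℕ) (A : Type*) [CommRing A] :
    Matrix (Fin (2 * n)) (Fin (2 * n)) A :=
  Matrix.of fun i j =>
    if i.val % 2 = 0 ∧ j.val = i.val + 1 then 1
    else if j.val % 2 = 0 ∧ i.val = j.val + 1 then -1
    else 0

/-- For every maximal ideal `𝔪` of `R`, the form that `B` induces on `P_𝔪 = R_𝔪 ⊗ P` has, in some
basis of `P_𝔪` with `2n` elements, a matrix that is congruent to `ψ_n` modulo `I R_𝔪`. -/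
def LocallyCongruentToStandard {P : Type*} [AddCommGroup P] [Module R P]
    (B : LinearMap.BilinForm R P) (n : ℕ) (I : Ideal R) : Prop :=
  ∀ (𝔪 : Ideal R) [𝔪.IsMaximal],
    ∃ b : Module.Basis (Fin (2 * n)) (Localization.AtPrime 𝔪) (Localization.AtPrime 𝔪 ⊗[R] P),
      ∀ i j : Fin (2 * n),
        LinearMap.BilinForm.baseChange (Localization.AtPrime 𝔪) B (b i) (b j)
            - standardAlternating n (Localization.AtPrime 𝔪) i j
          ∈ I.map (algebraMap R (Localization.AtPrime 𝔪))

end Forms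

section Groups

variable {R : Type*} [CommRing R]

/-- `σ` is the symplectic transvection
`p ↦ p + ⟨u, p⟩ v + ⟨v, p⟩ u + α ⟨u, p⟩ u`, where `⟨u, v⟩ = 0`. -/
def IsTransvectionOf {M : Type*} [AddCommGroup M] [Module R M] (B : LinearMap.BilinForm R M)
    (u v : M) (α : R) (σ : M ≃ₗ[R] M) : Prop :=
  B u v = 0 ∧ ∀ p : M, σ p = p + B u p • v + B v p • u + (α * B u p) • u

/-- The relative symplectic transvection group `Trans_Sp(M, IM)`: the group generated by the
symplectic transvections with `u ∈ M`, `v ∈ IM` and `α ∈ I`. -/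
def relTransSp {M : Type*} [AddCommGroup M] [Module R M] (B : LinearMap.BilinForm R M)
    (I : Ideal R) : Subgroup (M ≃ₗ[R] M) :=
  Subgroup.closure
    {σ | ∃ u v : M, ∃ α : R, v ∈ (I • ⊤ : Submodule R M) ∧ α ∈ I ∧ IsTransvectionOf B u v α σ}

variable {P : Type*} [AddCommGroup P] [Module R P]

/-- `σ` is the elementary symplectic transvection
`(a, b, p) ↦ (a, b - ⟨q, p⟩ + α a, p + a q)` of `Q`. -/
def IsLowerElementary (B : LinearMap.BilinForm R P) (q : P) (α : R)
    (σ : ((R × R) × P) ≃ₗ[R] ((R × R) × P)) : Prop :=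
  ∀ (a b : R) (p : P), σ ((a, b), p) = ((a, b - B q p + α * a), p + a • q)

/-- `σ` is the elementary symplectic transvection
`(a, b, p) ↦ (a + ⟨q, p⟩ - β b, b, p + b q)` of `Q`. -/
def IsUpperElementary (B : LinearMap.BilinForm R P) (q : P) (β : R)
    (σ : ((R × R) × P) ≃ₗ[R] ((R × R) × P)) : Prop :=
  ∀ (a b : R) (p : P), σ ((a, b), p) = ((a + B q p - β * b, b), p + b • q)

/-- The lower elementary maps are symplectic transvections of `Q`. -/
theorem IsLowerElementary.isTransvectionOf {B : LinearMap.BilinForm R P} {q : P} {α : R}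
    {σ : ((R × R) × P) ≃ₗ[R] ((R × R) × P)} (h : IsLowerElementary B q α σ) :
    IsTransvectionOf (formQ B) ((0, 1), 0) ((0, 0), -q) (-α) σ := by
  refine ⟨by simp [formQ, orthogonalSum, hyperbolicForm], ?_⟩
  rintro ⟨⟨a, b⟩, p⟩
  rw [h a b p]
  ext <;> simp [formQ, orthogonalSum, hyperbolicForm]
  ring

/-- The upper elementary maps are symplectic transvections of `Q`. -/
theorem IsUpperElementary.isTransvectionOf {B : LinearMap.BilinForm R P} {q : P} {β : R}
    {σ : ((R × R) × P) ≃ₗ[R] ((R × R) × P)} (h : IsUpperElementary B q β σ) :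
    IsTransvectionOf (formQ B) ((1, 0), 0) ((0, 0), q) (-β) σ := by
  refine ⟨by simp [formQ, orthogonalSum, hyperbolicForm], ?_⟩
  rintro ⟨⟨a, b⟩, p⟩
  rw [h a b p]
  ext <;> simp [formQ, orthogonalSum, hyperbolicForm]
  ring

/-- The group generated by the elementary symplectic transvections of `Q` whose parameters are
taken from `J` and `JP`. For `J = R` it is `ETrans_Sp(Q)`, for `J = I` it is `ETrans_Sp(IQ)`. -/
def elemTransSp (B : LinearMap.BilinForm R P) (J : Ideal R) :
    Subgroup (((R × R) × P) ≃ₗ[R] ((R × R) × P)) :=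
  Subgroup.closure
    {σ | ∃ q ∈ (J • ⊤ : Submodule R P), ∃ α ∈ J,
      IsLowerElementary B q α σ ∨ IsUpperElementary B q α σ}

/-- The relative elementary symplectic transvection group `ETrans_Sp(Q, IQ)`: the normal closure
of `ETrans_Sp(IQ)` in `ETrans_Sp(Q)`, as a group of automorphisms of `Q`. -/
def relElemTransSp (B : LinearMap.BilinForm R P) (I : Ideal R) :
    Subgroup (((R × R) × P) ≃ₗ[R] ((R × R) × P)) :=
  (Subgroup.normalClosure
    ((elemTransSp B I).subgroupOf (elemTransSp B ⊤) : Set (elemTransSp B (⊤ : Ideal R)))).map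
    (elemTransSp B ⊤).subtype

end Groups

end SymplecticTransvection


/-!
`Trans_Sp(Q, IQ)` is normalised by all isometries of `Q` and contains the elementary transvections
with parameters in `IP` and `I`, hence contains `ETrans_Sp(Q, IQ)`.

For the converse, every line transvection `x ↦ x + c ⟨w, x⟩ w` of `Q` is a word in elementary ones
whose parameters are polynomial in `c` and the components of `w`. Congruent data therefore give
congruent words modulo `ETrans_Sp(Q, IQ)`. To obtain such a word for `w ∈ R²`, write `1` as a
combination of squares of values of the form on `P`; these values generate the unit ideal. Finally,
let `L(w, c)` be the line transvection above. The transvection with vectors `u`, `v` and scalar `α`,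
where `⟨u, v⟩ = 0`, is `(L(u, 1) L(v, 1))⁻¹ L(u + v, 1) L(u, α)`. If `v ∈ IQ` and `α ∈ I`, replacing
`v` and `α` by `0` turns this product into `1`.
-/

namespace SymplecticTransvection

section Transvections

variable {R M : Type*} [CommRing R] [AddCommGroup M] [Module R M] {B : LinearMap.BilinForm R M}

/-- The linear map underlying a symplectic transvection, defined without the condition
`⟨u, v⟩ = 0`. -/
def transvectionMap (B : LinearMap.BilinForm R M) (u v : M) (α : R) : M →ₗ[R] M :=
  LinearMap.id + (B u).smulRight v + (B v).smulRight u + (α • B u).smulRight u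

theorem transvectionMap_apply (u v : M) (α : R) (x : M) :
    transvectionMap B u v α x = x + B u x • v + B v x • u + (α * B u x) • u := by
  simp [transvectionMap]

theorem transvectionMap_zero (u : M) : transvectionMap B u 0 0 = LinearMap.id := by
  simp [transvectionMap]

theorem transvectionMap_comp (hB : B.IsAlt) {u v v' : M} (α α' : R) (h : B u v = 0)
    (h' : B u v' = 0) :
    transvectionMap B u v α ∘ₗ transvectionMap B u v' α' =
      transvectionMap B u (v + v') (α + α' + B v v') := by
  have hvu : B v u = 0 := hB.isRefl _ _ h
  ext x
  simp only [LinearMap.comp_apply, transvectionMap_apply, map_add, map_smul, LinearMap.add_apply,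
    h', hvu, hB.self_eq_zero]
  module

/-- The symplectic transvection `x ↦ x + ⟨u, x⟩ v + ⟨v, x⟩ u + α ⟨u, x⟩ u`, for `⟨u, v⟩ = 0`,
as an automorphism. -/
def transvection (hB : B.IsAlt) (u v : M) (α : R) (h : B u v = 0) : M ≃ₗ[R] M :=
  LinearEquiv.ofLinearMap (transvectionMap B u v α) (transvectionMap B u (-v) (-α))
    (by
      rw [transvectionMap_comp hB _ _ h (by simp [h])]
      simp [hB.self_eq_zero, transvectionMap_zero])
    (by
      rw [transvectionMap_comp hB _ _ (by simp [h]) h]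
      simp [hB.self_eq_zero, transvectionMap_zero])

/-- The transvection `x ↦ x + c ⟨w, x⟩ w` along the line spanned by `w`. -/
abbrev lineTransvection (hB : B.IsAlt) (w : M) (c : R) : M ≃ₗ[R] M :=
  transvection hB w 0 c (map_zero _)

theorem transvection_apply (hB : B.IsAlt) {u v : M} (α : R) (h : B u v = 0) (x : M) :
    transvection hB u v α h x = x + B u x • v + B v x • u + (α * B u x) • u :=
  transvectionMap_apply u v α x

theorem lineTransvection_apply (hB : B.IsAlt) (w : M) (c : R) (x : M) :
    lineTransvection hB w c x = x + (c * B w x) • w := by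
  simp [transvection_apply]

theorem IsTransvectionOf.eq_transvection (hB : B.IsAlt) {u v : M} {α : R} {σ : M ≃ₗ[R] M}
    (hσ : IsTransvectionOf B u v α σ) : σ = transvection hB u v α hσ.1 :=
  LinearEquiv.ext fun x => by rw [hσ.2, transvection_apply]

theorem transvection_mul (hB : B.IsAlt) {u v v' : M} (α α' : R) (h : B u v = 0)
    (h' : B u v' = 0) :
    transvection hB u v α h * transvection hB u v' α' h' =
      transvection hB u (v + v') (α + α' + B v v') (by simp [h, h']) :=
  LinearEquiv.ext fun x => LinearMap.congr_fun (transvectionMap_comp hB α α' h h') x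

theorem transvection_mul_lineTransvection (hB : B.IsAlt) {u v : M} (α β : R) (h : B u v = 0) :
    transvection hB u v α h * lineTransvection hB u β = transvection hB u v (α + β) h := by
  simp [transvection_mul]

theorem lineTransvection_zero_right (hB : B.IsAlt) (w : M) : lineTransvection hB w 0 = 1 :=
  LinearEquiv.ext fun x => by simp [lineTransvection_apply]

theorem lineTransvection_zero_left (hB : B.IsAlt) (c : R) : lineTransvection hB 0 c = 1 :=
  LinearEquiv.ext fun x => by simp [lineTransvection_apply]

theorem transvection_inv (hB : B.IsAlt) {u v : M} (α : R) (h : B u v = 0) :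
    (transvection hB u v α h)⁻¹ = transvection hB u (-v) (-α) (by simp [h]) := by
  rw [inv_eq_iff_mul_eq_one, transvection_mul]
  simp [hB.self_eq_zero, lineTransvection_zero_right]

theorem transvection_add_right (hB : B.IsAlt) {u v v' : M} (h : B u v = 0) (h' : B u v' = 0) :
    transvection hB u (v + v') 0 (by simp [h, h']) =
      transvection hB u v 0 h * transvection hB u v' 0 h' * lineTransvection hB u (-B v v') := by
  rw [transvection_mul, transvection_mul_lineTransvection]
  simp only [zero_add, add_neg_cancel]

theorem transvection_swap (hB : B.IsAlt) {u v : M} (h : B u v = 0) :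
    transvection hB u v 0 h = transvection hB v u 0 (hB.isRefl _ _ h) := by
  ext x
  simp only [transvection_apply]
  module

theorem transvection_smul_left (hB : B.IsAlt) {u v : M} (h : B u v = 0) (a : R) :
    transvection hB (a • u) v 0 (by simp [h]) = transvection hB u (a • v) 0 (by simp [h]) := by
  ext x
  simp only [transvection_apply, map_smul, LinearMap.smul_apply]
  module

/-- The symplectic group of a form: the automorphisms that preserve it. -/
def isometryGroup (B : LinearMap.BilinForm R M) : Subgroup (M ≃ₗ[R] M) where
  carrier := {g | ∀ x y, B (g x) (g y) = B x y}
  one_mem' _ _ := rfl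
  mul_mem' hg hh x y := (hg _ _).trans (hh x y)
  inv_mem' {g} hg x y := by
    rw [← hg, ← LinearEquiv.mul_apply, ← LinearEquiv.mul_apply, mul_inv_cancel]
    rfl

theorem transvection_mem_isometryGroup (hB : B.IsAlt) {u v : M} (α : R) (h : B u v = 0) :
    transvection hB u v α h ∈ isometryGroup B := by
  intro x y
  have hvu : B v u = 0 := hB.isRefl _ _ h
  simp only [transvection_apply, map_add, map_smul, LinearMap.add_apply, LinearMap.smul_apply, h,
    hvu, hB.self_eq_zero, smul_eq_mul, ← hB.neg_eq x u, ← hB.neg_eq x v]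
  ring

theorem conj_transvection (hB : B.IsAlt) {u v : M} (α : R) (h : B u v = 0) {g : M ≃ₗ[R] M}
    (hg : g ∈ isometryGroup B) :
    g * transvection hB u v α h * g⁻¹ = transvection hB (g u) (g v) α ((hg u v).trans h) := by
  rw [mul_inv_eq_iff_eq_mul]
  ext x
  simp only [LinearEquiv.mul_apply, transvection_apply, map_add, map_smul, hg _ _]

theorem lineTransvection_add (hB : B.IsAlt) {u v : M} (h : B u v = 0) (c : R) :
    lineTransvection hB (u + v) c =
      lineTransvection hB u c * lineTransvection hB v c *
        transvection hB u (c • v) 0 (by simp [h]) := by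
  have hvu : B v u = 0 := hB.isRefl _ _ h
  ext x
  simp only [LinearEquiv.mul_apply, transvection_apply, map_add, map_smul, LinearMap.smul_apply,
    LinearMap.add_apply, smul_eq_mul, h, hvu, hB.self_eq_zero, map_zero, LinearMap.zero_apply]
  module

theorem transvection_eq_lineTransvection_mul (hB : B.IsAlt) {u v : M} (α : R) (h : B u v = 0) :
    transvection hB u v α h =
      (lineTransvection hB u 1 * lineTransvection hB v 1)⁻¹ * lineTransvection hB (u + v) 1 *
        lineTransvection hB u α := by
  rw [lineTransvection_add hB h, inv_mul_cancel_left]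
  simp only [one_smul, transvection_mul_lineTransvection, zero_add]

/-- The commutator of `transvection u v` and `transvection u v'` only produces the parameter
`2 ⟨v, v'⟩`. Conjugating by `lineTransvection v c` instead fixes `u` and moves `v'` along `v`, which
avoids the factor `2` at the price of a square. -/
theorem lineTransvection_mul_sq (hB : B.IsAlt) {u v v' : M} (h : B u v = 0) (h' : B u v' = 0)
    (c : R) :
    lineTransvection hB u (c * B v v' ^ 2) =
      (transvection hB u v' 0 h' * transvection hB u ((c * B v v') • v) 0 (by simp [h]))⁻¹ *
        (lineTransvection hB v c * transvection hB u v' 0 h' * (lineTransvection hB v c)⁻¹) := by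
  have hvu : B v u = 0 := hB.isRefl _ _ h
  rw [eq_inv_mul_iff_mul_eq, conj_transvection hB 0 h' (transvection_mem_isometryGroup hB c _),
    transvection_mul, transvection_mul_lineTransvection]
  simp only [lineTransvection_apply, hvu, map_smul, smul_eq_mul, ← hB.neg_eq v v', mul_zero,
    zero_smul, add_zero]
  congr 1
  ring

theorem relTransSp_le_isometryGroup (hB : B.IsAlt) (J : Ideal R) :
    relTransSp B J ≤ isometryGroup B := by
  refine (Subgroup.closure_le _).2 ?_
  rintro σ ⟨u, v, α, -, -, hσ⟩
  rw [hσ.eq_transvection hB]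
  exact transvection_mem_isometryGroup hB α hσ.1

theorem conj_mem_relTransSp (hB : B.IsAlt) {J : Ideal R} {g σ : M ≃ₗ[R] M}
    (hg : g ∈ isometryGroup B) (hσ : σ ∈ relTransSp B J) : g * σ * g⁻¹ ∈ relTransSp B J := by
  suffices relTransSp B J ≤ (relTransSp B J).comap (MulAut.conj g).toMonoidHom from this hσ
  refine (Subgroup.closure_le _).2 ?_
  rintro σ ⟨u, v, α, hv, hα, hσ⟩
  refine Subgroup.subset_closure ⟨g u, g v, α,
    Submodule.smul_top_le_comap_smul_top J g.toLinearMap hv, hα, (hg u v).trans hσ.1, ?_⟩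
  simp [hσ.eq_transvection hB, conj_transvection hB α hσ.1 hg, transvection_apply]

end Transvections

section ModIdeal

variable {R M N : Type*} [CommRing R] [AddCommGroup M] [Module R M] [AddCommGroup N] [Module R N]
  {I : Ideal R}

theorem smodEq_smul_top_map (f : M →ₗ[R] N) {x x' : M}
    (hx : x ≡ x' [SMOD (I • ⊤ : Submodule R M)]) : f x ≡ f x' [SMOD (I • ⊤ : Submodule R N)] :=
  (hx.map f).mono (Submodule.map_le_iff_le_comap.2 (Submodule.smul_top_le_comap_smul_top I f))

theorem smodEq_dual_apply (f : Module.Dual R M) {x x' : M}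
    (hx : x ≡ x' [SMOD (I • ⊤ : Submodule R M)]) : f x ≡ f x' [SMOD I] := by
  simpa using smodEq_smul_top_map f hx

theorem smodEq_smul_smul {a a' : R} {x x' : M} (ha : a ≡ a' [SMOD I])
    (hx : x ≡ x' [SMOD (I • ⊤ : Submodule R M)]) :
    a • x ≡ a' • x' [SMOD (I • ⊤ : Submodule R M)] := by
  refine (hx.smul a).trans (SModEq.sub_mem.2 ?_)
  rw [← sub_smul]
  exact Submodule.smul_mem_smul (SModEq.sub_mem.1 ha) trivial

end ModIdeal

section ValueIdeal

variable {R P : Type*} [CommRing R] [AddCommGroup P] [Module R P]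

/-- By the dual basis lemma the ideal `J` of values satisfies `JP = P`, so that some `r ≡ 1 mod J`
kills `P`; as `P` has full support, `r` is nilpotent. -/
theorem span_range_form_eq_top [Module.Finite R P] [Module.Projective R P]
    (hrank : ∀ 𝔭 : PrimeSpectrum R, 0 < Module.rankAtStalk (R := R) P 𝔭)
    {B : LinearMap.BilinForm R P}
    (hB : Function.Surjective (fun x : P => (B x : Module.Dual R P))) :
    Ideal.span (Set.range fun x : P × P => B x.1 x.2) = ⊤ := by
  set J := Ideal.span (Set.range fun x : P × P => B x.1 x.2)
  have hJP : (⊤ : Submodule R P) ≤ J • ⊤ := by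
    obtain ⟨s, hs⟩ := Module.projective_def'.1 ‹Module.Projective R P›
    intro p _
    rw [← LinearMap.id_apply (R := R) p, ← hs, LinearMap.comp_apply,
      Finsupp.linearCombination_apply]
    refine Submodule.sum_mem _ fun m _ => Submodule.smul_mem_smul ?_ trivial
    obtain ⟨x, hx⟩ := hB ((Finsupp.lapply m).comp s)
    exact Ideal.subset_span ⟨(x, p), LinearMap.congr_fun hx p⟩
  obtain ⟨r, hrJ, hrP⟩ := Submodule.exists_sub_one_mem_and_smul_eq_zero_of_fg_of_le_smul J ⊤
    Module.Finite.fg_top hJP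
  have hr : IsNilpotent r := nilpotent_iff_mem_prime.2 fun 𝔭 h𝔭 => by
    have hsupp := (Module.rankAtStalk_pos_iff_mem_support _).1 (hrank ⟨𝔭, h𝔭⟩)
    rw [Module.support_eq_zeroLocus] at hsupp
    exact hsupp (Module.mem_annihilator.2 fun p => hrP p trivial)
  exact J.eq_top_of_isUnit_mem hrJ hr.isUnit_sub_one

end ValueIdeal

section HyperbolicSum

variable {R P : Type*} [CommRing R] [AddCommGroup P] [Module R P] {B : LinearMap.BilinForm R P}

theorem formQ_apply (x y : (R × R) × P) :
    formQ B x y = x.1.1 * y.1.2 - y.1.1 * x.1.2 + B x.2 y.2 := by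
  simp [formQ, orthogonalSum, hyperbolicForm]

theorem formQ_isAlt (hB : B.IsAlt) : (formQ B).IsAlt := by
  intro x
  rw [formQ_apply, hB.self_eq_zero]
  ring

theorem formQ_inl_inr (e : R × R) (q : P) : formQ B (e, 0) (0, q) = 0 := by
  simp [formQ_apply]

/-- The transvection of `Q` with vectors `e ∈ R²` and `q ∈ P`. For `e = (1, 0)` and `e = (0, 1)`
these are the elementary ones. -/
abbrev mixedTransvection (hB : B.IsAlt) (e : R × R) (q : P) (α : R) :
    ((R × R) × P) ≃ₗ[R] ((R × R) × P) :=
  transvection (formQ_isAlt hB) (e, 0) (0, q) α (formQ_inl_inr e q)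

theorem mixedTransvection_swap (hB : B.IsAlt) (e : R × R) (q : P) :
    mixedTransvection hB e q 0 =
      transvection (formQ_isAlt hB) (0, q) (e, 0) 0 (by simp [formQ_apply]) :=
  transvection_swap (formQ_isAlt hB) _

theorem mixedTransvection_smul_left (hB : B.IsAlt) (a : R) (e : R × R) (q : P) :
    mixedTransvection hB (a • e) q 0 = mixedTransvection hB e (a • q) 0 := by
  simpa using transvection_smul_left (formQ_isAlt hB) (formQ_inl_inr e q) a

theorem mixedTransvection_add_left (hB : B.IsAlt) (e e' : R × R) (q : P) :
    mixedTransvection hB (e + e') q 0 =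
      mixedTransvection hB e q 0 * mixedTransvection hB e' q 0 *
        lineTransvection (formQ_isAlt hB) (0, q) (-hyperbolicForm R e e') := by
  rw [mixedTransvection_swap, mixedTransvection_swap, mixedTransvection_swap]
  have hadd := transvection_add_right (formQ_isAlt hB) (u := (0, q)) (v := (e, 0)) (v' := (e', 0))
    (by simp [formQ_apply]) (by simp [formQ_apply])
  simpa [formQ, orthogonalSum] using hadd

theorem mixedTransvection_eq_elementary_mul (hB : B.IsAlt) (e : R × R) (q : P) :
    mixedTransvection hB e q 0 =
      mixedTransvection hB (1, 0) (e.1 • q) 0 * mixedTransvection hB (0, 1) (e.2 • q) 0 *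
        lineTransvection (formQ_isAlt hB) (0, q) (-(e.1 * e.2)) := by
  have hadd := mixedTransvection_add_left hB (e.1 • (1, 0)) (e.2 • (0, 1)) q
  rw [mixedTransvection_smul_left, mixedTransvection_smul_left] at hadd
  simpa [hyperbolicForm] using hadd

theorem lineTransvection_inr_eq (hB : B.IsAlt) (q : P) (c : R) :
    lineTransvection (formQ_isAlt hB) (0, q) c =
      (mixedTransvection hB (0, 1) q 0 * mixedTransvection hB (1, 0) (c • q) 0)⁻¹ *
        (lineTransvection (formQ_isAlt hB) ((1, 0), 0) c * mixedTransvection hB (0, 1) q 0 *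
          (lineTransvection (formQ_isAlt hB) ((1, 0), 0) c)⁻¹) := by
  have hsq := lineTransvection_mul_sq (formQ_isAlt hB) (u := (0, q)) (v := ((1, 0), 0))
    (v' := ((0, 1), 0)) (by simp [formQ_apply]) (by simp [formQ_apply]) c
  rw [← mixedTransvection_smul_left, mixedTransvection_swap, mixedTransvection_swap]
  simpa [formQ_apply] using hsq

theorem lineTransvection_inl_mul_sq (hB : B.IsAlt) (e : R × R) (c : R) (p q : P) :
    lineTransvection (formQ_isAlt hB) (e, 0) (c * B p q ^ 2) =
      (mixedTransvection hB e q 0 * mixedTransvection hB e ((c * B p q) • p) 0)⁻¹ *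
        (lineTransvection (formQ_isAlt hB) (0, p) c * mixedTransvection hB e q 0 *
          (lineTransvection (formQ_isAlt hB) (0, p) c)⁻¹) := by
  simpa [formQ_apply] using lineTransvection_mul_sq (formQ_isAlt hB)
    (formQ_inl_inr e p) (formQ_inl_inr e q) c

theorem lineTransvection_eq_inl_mul_inr (hB : B.IsAlt) (w : (R × R) × P) (c : R) :
    lineTransvection (formQ_isAlt hB) w c =
      lineTransvection (formQ_isAlt hB) (w.1, 0) c *
        lineTransvection (formQ_isAlt hB) (0, w.2) c * mixedTransvection hB w.1 (c • w.2) 0 := by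
  simpa using lineTransvection_add (formQ_isAlt hB) (formQ_inl_inr w.1 w.2) c

theorem mixedTransvection_mem_elemTransSp (hB : B.IsAlt) {e : R × R}
    (he : e = (1, 0) ∨ e = (0, 1)) {J : Ideal R} {q : P} {α : R}
    (hq : q ∈ (J • ⊤ : Submodule R P)) (hα : α ∈ J) :
    mixedTransvection hB e q α ∈ elemTransSp B J := by
  rcases he with rfl | rfl
  · refine Subgroup.subset_closure ⟨q, hq, -α, neg_mem hα, Or.inr fun a b p => ?_⟩
    rw [transvection_apply]
    ext <;> simp [formQ_apply]
  · refine Subgroup.subset_closure ⟨-q, neg_mem hq, -α, neg_mem hα, Or.inl fun a b p => ?_⟩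
    rw [transvection_apply]
    ext <;> simp [formQ_apply]

theorem elemTransSp_le_relTransSp (J : Ideal R) : elemTransSp B J ≤ relTransSp (formQ B) J := by
  refine (Subgroup.closure_le _).2 ?_
  have inr_mem {q : P} (hq : q ∈ (J • ⊤ : Submodule R P)) :
      (((0, 0), q) : (R × R) × P) ∈ (J • ⊤ : Submodule R ((R × R) × P)) :=
    Submodule.smul_top_le_comap_smul_top J (LinearMap.inr R (R × R) P) hq
  rintro σ ⟨q, hq, α, hα, hσ | hσ⟩
  · exact Subgroup.subset_closure
      ⟨_, _, _, inr_mem (neg_mem hq), neg_mem hα, hσ.isTransvectionOf⟩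
  · exact Subgroup.subset_closure ⟨_, _, _, inr_mem hq, neg_mem hα, hσ.isTransvectionOf⟩

theorem elemTransSp_mono {J K : Ideal R} (h : J ≤ K) : elemTransSp B J ≤ elemTransSp B K :=
  Subgroup.closure_mono fun _ ⟨q, hq, α, hα, hσ⟩ =>
    ⟨q, Submodule.smul_mono_left h hq, α, h hα, hσ⟩

theorem elemTransSp_le_relElemTransSp (I : Ideal R) : elemTransSp B I ≤ relElemTransSp B I :=
  fun σ hσ => ⟨⟨σ, elemTransSp_mono le_top hσ⟩, Subgroup.subset_normalClosure hσ, rfl⟩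

theorem conj_mem_relElemTransSp {I : Ideal R} {g σ : ((R × R) × P) ≃ₗ[R] ((R × R) × P)}
    (hg : g ∈ elemTransSp B ⊤) (hσ : σ ∈ relElemTransSp B I) :
    g * σ * g⁻¹ ∈ relElemTransSp B I := by
  obtain ⟨σ, hσ, rfl⟩ := hσ
  exact ⟨⟨g, hg⟩ * σ * ⟨g, hg⟩⁻¹, Subgroup.normalClosure_normal.conj_mem σ hσ ⟨g, hg⟩, rfl⟩

theorem relElemTransSp_le_relTransSp (hB : B.IsAlt) (I : Ideal R) :
    relElemTransSp B I ≤ relTransSp (formQ B) I := by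
  have hQ := formQ_isAlt hB
  have : ((relTransSp (formQ B) I).subgroupOf (elemTransSp B ⊤)).Normal :=
    ⟨fun σ hσ g => conj_mem_relTransSp hQ
      (relTransSp_le_isometryGroup hQ ⊤ (elemTransSp_le_relTransSp ⊤ g.2)) hσ⟩
  have hle : Subgroup.normalClosure
      ((elemTransSp B I).subgroupOf (elemTransSp B ⊤) : Set (elemTransSp B (⊤ : Ideal R))) ≤
      (relTransSp (formQ B) I).subgroupOf (elemTransSp B ⊤) :=
    Subgroup.normalClosure_le_normal fun σ hσ => elemTransSp_le_relTransSp I hσ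
  exact Subgroup.map_le_iff_le_comap.2 hle

/-- Congruence of elements of `ETrans_Sp(Q)` modulo `ETrans_Sp(Q, IQ)`. -/
def ElemCongr (B : LinearMap.BilinForm R P) (I : Ideal R)
    (σ τ : ((R × R) × P) ≃ₗ[R] ((R × R) × P)) : Prop :=
  σ ∈ elemTransSp B ⊤ ∧ σ⁻¹ * τ ∈ relElemTransSp B I

namespace ElemCongr

variable {I : Ideal R} {σ σ' τ τ' : ((R × R) × P) ≃ₗ[R] ((R × R) × P)}

theorem refl (hσ : σ ∈ elemTransSp B ⊤) : ElemCongr B I σ σ :=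
  ⟨hσ, by simp⟩

theorem mul (h : ElemCongr B I σ τ) (h' : ElemCongr B I σ' τ') :
    ElemCongr B I (σ * σ') (τ * τ') := by
  refine ⟨mul_mem h.1 h'.1, ?_⟩
  have hconj := conj_mem_relElemTransSp (inv_mem h'.1) h.2
  have hsplit : (σ * σ')⁻¹ * (τ * τ') = σ'⁻¹ * (σ⁻¹ * τ) * σ'⁻¹⁻¹ * (σ'⁻¹ * τ') := by group
  exact hsplit ▸ mul_mem hconj h'.2

theorem inv (h : ElemCongr B I σ τ) : ElemCongr B I σ⁻¹ τ⁻¹ := by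
  refine ⟨inv_mem h.1, ?_⟩
  have hconj := conj_mem_relElemTransSp h.1 (inv_mem h.2)
  have hrw : σ⁻¹⁻¹ * τ⁻¹ = σ * (σ⁻¹ * τ)⁻¹ * σ⁻¹ := by group
  exact hrw ▸ hconj

theorem conj (h : ElemCongr B I σ τ) (h' : ElemCongr B I σ' τ') :
    ElemCongr B I (σ * σ' * σ⁻¹) (τ * τ' * τ⁻¹) :=
  (h.mul h').mul h.inv

theorem mem_relElemTransSp (h : ElemCongr B I σ 1) : σ ∈ relElemTransSp B I := by
  simpa using h.2

end ElemCongr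

variable {I : Ideal R}

theorem elemCongr_elementary (hB : B.IsAlt) {e : R × R} (he : e = (1, 0) ∨ e = (0, 1))
    {q q' : P} {α α' : R} (hq : q ≡ q' [SMOD (I • ⊤ : Submodule R P)]) (hα : α ≡ α' [SMOD I]) :
    ElemCongr B I (mixedTransvection hB e q α) (mixedTransvection hB e q' α') := by
  refine ⟨mixedTransvection_mem_elemTransSp hB he (by simp) trivial, ?_⟩
  have hqq : -q + q' ∈ (I • ⊤ : Submodule R P) := by
    simpa [sub_eq_neg_add] using SModEq.sub_mem.1 hq.symm
  have hBq : B (-q) q' ≡ B (-q) q [SMOD I] := smodEq_dual_apply (B (-q)) hq.symm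
  have hαα : -α + α' + B (-q) q' ∈ I := by
    have := SModEq.sub_mem.1 ((hα.symm.sub (SModEq.refl α)).add hBq)
    simpa [hB.self_eq_zero, sub_eq_neg_add] using this
  convert elemTransSp_le_relElemTransSp I (mixedTransvection_mem_elemTransSp hB he hqq hαα) using 1
  rw [transvection_inv, transvection_mul]
  simp [formQ_apply]

theorem elemCongr_lineTransvection_inr (hB : B.IsAlt) {q q' : P} {c c' : R}
    (hq : q ≡ q' [SMOD (I • ⊤ : Submodule R P)]) (hc : c ≡ c' [SMOD I]) :
    ElemCongr B I (lineTransvection (formQ_isAlt hB) (0, q) c)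
      (lineTransvection (formQ_isAlt hB) (0, q') c') := by
  rw [lineTransvection_inr_eq hB, lineTransvection_inr_eq hB]
  have hf := elemCongr_elementary hB (.inr rfl) hq (.refl 0)
  have hec := elemCongr_elementary hB (.inl rfl) (smodEq_smul_smul hc hq) (.refl 0)
  have hline := elemCongr_elementary hB (.inl rfl) (.refl 0) hc
  exact (hf.mul hec).inv.mul (hline.conj hf)

theorem elemCongr_mixedTransvection (hB : B.IsAlt) {e e' : R × R} {q q' : P}
    (he : e ≡ e' [SMOD (I • ⊤ : Submodule R (R × R))])
    (hq : q ≡ q' [SMOD (I • ⊤ : Submodule R P)]) :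
    ElemCongr B I (mixedTransvection hB e q 0) (mixedTransvection hB e' q' 0) := by
  rw [mixedTransvection_eq_elementary_mul hB e, mixedTransvection_eq_elementary_mul hB e']
  have h₁ : e.1 ≡ e'.1 [SMOD I] := smodEq_dual_apply (LinearMap.fst R R R) he
  have h₂ : e.2 ≡ e'.2 [SMOD I] := smodEq_dual_apply (LinearMap.snd R R R) he
  exact ((elemCongr_elementary hB (.inl rfl) (smodEq_smul_smul h₁ hq) (.refl 0)).mul
    (elemCongr_elementary hB (.inr rfl) (smodEq_smul_smul h₂ hq) (.refl 0))).mul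
    (elemCongr_lineTransvection_inr hB hq (h₁.mul h₂).neg)

theorem elemCongr_lineTransvection_inl_mul_sq (hB : B.IsAlt) {e e' : R × R} {c c' : R}
    (he : e ≡ e' [SMOD (I • ⊤ : Submodule R (R × R))]) (hc : c ≡ c' [SMOD I]) (p q : P) :
    ElemCongr B I (lineTransvection (formQ_isAlt hB) (e, 0) (c * B p q ^ 2))
      (lineTransvection (formQ_isAlt hB) (e', 0) (c' * B p q ^ 2)) := by
  rw [lineTransvection_inl_mul_sq hB, lineTransvection_inl_mul_sq hB]
  have hq := elemCongr_mixedTransvection hB he (.refl q)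
  have hp := elemCongr_mixedTransvection hB he
    (smodEq_smul_smul (hc.mul (.refl (B p q))) (.refl p))
  exact (hq.mul hp).inv.mul ((elemCongr_lineTransvection_inr hB (.refl p) hc).conj hq)

/-- The squares of the values of `B` still generate the unit ideal. -/
theorem elemCongr_lineTransvection_inl (hB : B.IsAlt)
    (hspan : Ideal.span (Set.range fun x : P × P => B x.1 x.2) = ⊤) {e e' : R × R} {c c' : R}
    (he : e ≡ e' [SMOD (I • ⊤ : Submodule R (R × R))]) (hc : c ≡ c' [SMOD I]) :
    ElemCongr B I (lineTransvection (formQ_isAlt hB) (e, 0) c)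
      (lineTransvection (formQ_isAlt hB) (e', 0) c') := by
  suffices H : ∀ r ∈ Ideal.span ((· ^ 2) '' Set.range fun x : P × P => B x.1 x.2),
      ∀ c c' : R, c ≡ c' [SMOD I] →
        ElemCongr B I (lineTransvection (formQ_isAlt hB) (e, 0) (c * r))
          (lineTransvection (formQ_isAlt hB) (e', 0) (c' * r)) by
    simpa using H 1 (by simp [Ideal.span_pow_eq_top _ hspan]) c c' hc
  intro r hr
  induction hr using Submodule.span_induction with
  | mem r hr =>
    obtain ⟨_, ⟨⟨p, q⟩, rfl⟩, rfl⟩ := hr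
    exact fun c c' hc => elemCongr_lineTransvection_inl_mul_sq hB he hc p q
  | zero =>
    intro c c' _
    simpa only [mul_zero, lineTransvection_zero_right] using ElemCongr.refl (one_mem _)
  | add r s _ _ ihr ihs =>
    intro c c' hc
    simpa [mul_add, transvection_mul_lineTransvection] using (ihr c c' hc).mul (ihs c c' hc)
  | smul d r _ ih =>
    intro c c' hc
    simpa [mul_assoc] using ih (c * d) (c' * d) (hc.mul (.refl d))

theorem elemCongr_lineTransvection (hB : B.IsAlt)
    (hspan : Ideal.span (Set.range fun x : P × P => B x.1 x.2) = ⊤) {w w' : (R × R) × P} {c c' : R}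
    (hw : w ≡ w' [SMOD (I • ⊤ : Submodule R ((R × R) × P))]) (hc : c ≡ c' [SMOD I]) :
    ElemCongr B I (lineTransvection (formQ_isAlt hB) w c)
      (lineTransvection (formQ_isAlt hB) w' c') := by
  have he := smodEq_smul_top_map (LinearMap.fst R (R × R) P) hw
  have hp := smodEq_smul_top_map (LinearMap.snd R (R × R) P) hw
  rw [lineTransvection_eq_inl_mul_inr hB w, lineTransvection_eq_inl_mul_inr hB w']
  exact ((elemCongr_lineTransvection_inl hB hspan he hc).mul
    (elemCongr_lineTransvection_inr hB hp hc)).mul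
    (elemCongr_mixedTransvection hB he (smodEq_smul_smul hc hp))

theorem relTransSp_le_relElemTransSp (hB : B.IsAlt)
    (hspan : Ideal.span (Set.range fun x : P × P => B x.1 x.2) = ⊤) :
    relTransSp (formQ B) I ≤ relElemTransSp B I := by
  have hQ := formQ_isAlt hB
  refine (Subgroup.closure_le _).2 ?_
  rintro σ ⟨u, v, α, hv, hα, hσ⟩
  rw [hσ.eq_transvection hQ, transvection_eq_lineTransvection_mul]
  have hv0 : v ≡ 0 [SMOD (I • ⊤ : Submodule R ((R × R) × P))] := SModEq.zero.2 hv
  have hu_one := elemCongr_lineTransvection hB hspan (I := I) (.refl u) (.refl 1)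
  have hv_one := elemCongr_lineTransvection hB hspan hv0 (.refl 1)
  have huv_one := elemCongr_lineTransvection hB hspan ((SModEq.refl u).add hv0) (.refl 1)
  have hu_α := elemCongr_lineTransvection hB hspan (.refl u) (SModEq.zero.2 hα)
  apply ElemCongr.mem_relElemTransSp
  simpa [lineTransvection_zero_left, lineTransvection_zero_right] using
    ((hu_one.mul hv_one).inv.mul huv_one).mul hu_α

end HyperbolicSum

end SymplecticTransvection

theorem mainTheorem2_general {R : Type*} [CommRing R] (I : Ideal R)
    {P : Type*} [AddCommGroup P] [Module R P] (B : LinearMap.BilinForm R P) (hB : B.IsAlt)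
    (hspan : Ideal.span (Set.range fun x : P × P => B x.1 x.2) = ⊤) :
    SymplecticTransvection.relTransSp (SymplecticTransvection.formQ B) I =
      SymplecticTransvection.relElemTransSp B I :=
  le_antisymm (SymplecticTransvection.relTransSp_le_relElemTransSp hB hspan)
    (SymplecticTransvection.relElemTransSp_le_relTransSp hB I)

theorem mainTheorem2 {R : Type*} [CommRing R] (h2 : IsUnit (2 : R)) (I : Ideal R)
    {P : Type*} [AddCommGroup P] [Module R P] [Module.Finite R P] [Module.Projective R P]
    (n : ℕ) (hn : 1 ≤ n)
    (hrank : ∀ 𝔭 : PrimeSpectrum R, Module.rankAtStalk (R := R) P 𝔭 = 2 * n)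
    (B : LinearMap.BilinForm R P) (hB : SymplecticTransvection.IsSymplecticForm B)
    (hloc : SymplecticTransvection.LocallyCongruentToStandard B n I) :
    SymplecticTransvection.relTransSp (SymplecticTransvection.formQ B) I =
      SymplecticTransvection.relElemTransSp B I :=
  mainTheorem2_general I B hB.isAlt
    (SymplecticTransvection.span_range_form_eq_top (fun 𝔭 => by grind) hB.bijective.surjective)
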